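/- Let $(R,\mathfrak m)$ be a (Noetherian) Cohen–Macaulay local ring and let $I$ be an $\mathfrak m$-primary ideal, with integral closure $\overline I$ (the set of all $x\in R$ satisfying an equation $x^m+c_1x^{m-1}+\cdots+c_m=0$ with $m\ge 1$ and $c_k\in I^k$). If $J\subseteq I$ is a complete intersection (an ideal generated by a regular sequence) with $\operatorname{ht} J=\operatorname{ht} I$, then $$J:(J:I)\subseteq\overline I .$$ Moreover, the annihilator of the last non-vanishing Koszul homology module of $I$ is contained in $\overline I$: if $a_1,\dots,a_n$ is a minimal generating set of $I$ and $i$ is the largest index with $H_i(a_1,\dots,a_n)\neq 0$, where $H_i$ denotes the homology of the Koszul complex of $a_1,\dots,a_n$ on $R$ (such an index exists), then $\operatorname{ann}_R H_i(a_1,\dots,a_n)\subseteq\overline I$. -/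

import Mathlib

open IsLocalRing CategoryTheory

universe u

noncomputable section

/-- The depth of a Noetherian local ring: the supremum of the lengths of the regular sequences on
`R`. (A regular sequence on `R` satisfies `R ≠ (r₁, …, r_k) R`, so it lies in the maximal ideal.) -/
def localDepth (R : Type u) [CommRing R] : ℕ∞ :=
  ⨆ rs : {rs : List R // RingTheory.Sequence.IsRegular R rs}, (rs.1.length : ℕ∞)

/-- Cohen–Macaulay local rings: Noetherian local rings with `depth R = dim R`. -/
class IsCohenMacaulayLocal (R : Type u) [CommRing R] : Prop extends
    IsLocalRing R, IsNoetherianRing R where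
  depth_eq_dim : (localDepth R : WithBot ℕ∞) = ringKrullDim R

section

variable {R : Type u} [CommRing R]

/-- An ideal is a complete intersection if it is generated by a regular sequence. -/
def IsCompleteIntersectionIdeal (J : Ideal R) : Prop :=
  ∃ rs : List R, RingTheory.Sequence.IsRegular R rs ∧ J = Ideal.ofList rs

/-- The integral closure of an ideal `I`: the set of the elements `x` of `R` which satisfy an
equation `x ^ m + c₁ x ^ (m - 1) + ⋯ + c_m = 0` with `c_k ∈ I ^ k`. -/
def idealIntegralClosure (I : Ideal R) : Set R :=
  {x | ∃ p : Polynomial R, p.Monic ∧ p.eval x = 0 ∧ ∀ i, p.coeff i ∈ I ^ (p.natDegree - i)}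

variable {n : ℕ}

/-- The linear form `e_i ↦ a_i` on the free module `R ^ n`. -/
def koszulForm (a : Fin n → R) : Module.Dual R (Fin n → R) :=
  Fintype.linearCombination R a

/-- The Koszul differential on the whole exterior algebra of `R ^ n`: the contraction with the
linear form `e_i ↦ a_i`, the antiderivation with
`e_{i_1} ∧ ⋯ ∧ e_{i_k} ↦ ∑ j, (-1) ^ (j - 1) a_{i_j} e_{i_1} ∧ ⋯ ê_{i_j} ⋯ ∧ e_{i_k}`. -/
def koszulContract (a : Fin n → R) :
    ExteriorAlgebra R (Fin n → R) →ₗ[R] ExteriorAlgebra R (Fin n → R) :=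
  CliffordAlgebra.contractLeft (Q := (0 : QuadraticForm R (Fin n → R))) (koszulForm a)

lemma koszulContract_ι_mul (a : Fin n → R) (v : Fin n → R) (x : ExteriorAlgebra R (Fin n → R)) :
    koszulContract a (ExteriorAlgebra.ι R v * x) =
      koszulForm a v • x - ExteriorAlgebra.ι R v * koszulContract a x :=
  CliffordAlgebra.contractLeft_ι_mul (Q := (0 : QuadraticForm R (Fin n → R))) _ _ _

lemma koszulContract_koszulContract (a : Fin n → R) (x : ExteriorAlgebra R (Fin n → R)) :
    koszulContract a (koszulContract a x) = 0 :=
  CliffordAlgebra.contractLeft_contractLeft (Q := (0 : QuadraticForm R (Fin n → R))) _ _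

lemma koszulContract_mem (a : Fin n → R) (i : ℕ) :
    ∀ x ∈ ⋀[R]^(i + 1) (Fin n → R), koszulContract a x ∈ ⋀[R]^i (Fin n → R) := by
  induction i with
  | zero =>
    intro x hx
    obtain ⟨v, rfl⟩ : x ∈ LinearMap.range (ExteriorAlgebra.ι R) := by simpa using hx
    have h := koszulContract_ι_mul a v 1
    have h1 : koszulContract a 1 = 0 :=
      CliffordAlgebra.contractLeft_one (Q := (0 : QuadraticForm R (Fin n → R))) _
    rw [mul_one, h1, mul_zero, sub_zero] at h
    rw [h]
    exact Submodule.smul_mem _ _ (by simp)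
  | succ i ih =>
    intro x hx
    rw [ExteriorAlgebra.exteriorPower, pow_succ'] at hx
    induction hx using Submodule.mul_induction_on' with
    | mem_mul_mem y hy z hz =>
      obtain ⟨v, rfl⟩ := hy
      rw [koszulContract_ι_mul]
      refine Submodule.sub_mem _ (Submodule.smul_mem _ _ hz) ?_
      rw [ExteriorAlgebra.exteriorPower, pow_succ']
      exact Submodule.mul_mem_mul ⟨v, rfl⟩ (ih z hz)
    | add y _ z _ hy hz => rw [map_add]; exact Submodule.add_mem _ hy hz

/-- The Koszul differential `⋀ ^ (i + 1) (R ^ n) → ⋀ ^ i (R ^ n)`. -/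
def koszulDifferential (a : Fin n → R) (i : ℕ) :
    ⋀[R]^(i + 1) (Fin n → R) →ₗ[R] ⋀[R]^i (Fin n → R) :=
  (koszulContract a).restrict (koszulContract_mem a i)

/-- The Koszul complex `⋯ → ⋀ ^ 2 (R ^ n) → R ^ n → R → 0` of a sequence `a_1, …, a_n`. -/
def koszulChainComplex (a : Fin n → R) : ChainComplex (ModuleCat.{u} R) ℕ :=
  ChainComplex.of (fun i => ModuleCat.of R (⋀[R]^i (Fin n → R)))
    (fun i => ModuleCat.ofHom (koszulDifferential a i)) (fun i => by
      ext x
      exact koszulContract_koszulContract a _)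

/-- The Koszul homology module `H_i(a_1, …, a_n)`. -/
abbrev koszulHomology (a : Fin n → R) (i : ℕ) : ModuleCat.{u} R :=
  (koszulChainComplex a).homology i

/-- `H_i(a_1, …, a_n)` is the last non-vanishing Koszul homology module. -/
def IsLastNonvanishingKoszul (a : Fin n → R) (i : ℕ) : Prop :=
  Nontrivial (koszulHomology a i) ∧ ∀ j, i < j → Subsingleton (koszulHomology a j)

/-- `a_1, …, a_n` is a minimal generating set of `I`: it generates `I`, and `n` is the least number
of generators of `I`. -/
def IsMinimalGenerators (I : Ideal R) (a : Fin n → R) : Prop :=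
  Ideal.span (Set.range a) = I ∧ n = Submodule.spanFinrank I

end

end

/-! Let J = (a_1, …, a_d) ⊆ I be generated by a regular sequence and m-primary, and let x(J : I) ⊆
J. Let r elements generate the socle of R/J, and put J_k = (a_1^{k+1}, …, a_d^{k+1}). Multiplication
by powers of the a_i carries J : I and J : m to J_k : I and J_k : m modulo J_k, so x(J_k : I) ⊆ J_k
and r elements still generate the socle of R/J_k (`SocleBounded.sup_span_pow`).

Over A = R/J_k the injective hull E of the residue field is faithful and generated by r elements.
Injectivity gives xE ⊆ IE, because x is killed by ann I. By Cayley–Hamilton, x satisfies modulo J_k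
an integral equation over I of degree r. Since r does not depend on k, x^r lies in ∑_{i<r}
I^{r-i}x^i + m^{k+1} for all k, and Krull's intersection theorem removes the error term
(`mem_idealIntegralClosure_of_mul_colon_le`).

For the Koszul statement, take a regular sequence of length d = dim R in I, generating J. Shifting
degree by one for each element, ann H_{n-d}(a; R) kills H_n(a; R/J) = (J : I)/J, so the first
argument applies to it. The same shifts give H_j(a; R) = 0 for j > n - d, while H_{n-d} = 0 would
make 1 integral over I. Coefficients in R/K are expressed by congruences modulo K in the exterior
algebra over R. -/

section ArtinianLocal

/-! ### Injective hulls and integral equations over Artinian local rings. -/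

variable {A : Type u} [CommRing A] [IsLocalRing A]

/-- If the maximal ideal of a local ring is nilpotent, then every nonzero element of a module has
a nonzero multiple that is killed by the maximal ideal. -/
lemma exists_smul_ne_zero_of_isNilpotent_maximalIdeal {M : Type*} [AddCommGroup M] [Module A M]
    (hA : IsNilpotent (maximalIdeal A)) {x : M} (hx : x ≠ 0) :
    ∃ c : A, c • x ≠ 0 ∧ ∀ a ∈ maximalIdeal A, a • c • x = 0 := by
  classical
  have hex : ∃ k, ∀ a ∈ maximalIdeal A ^ k, a • x = 0 := by
    obtain ⟨k, hk⟩ := hA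
    refine ⟨k, fun a ha => ?_⟩
    rw [hk] at ha
    rw [(Ideal.mem_bot.mp ha), zero_smul]
  obtain ⟨k, hk, hmin⟩ : ∃ k, (∀ a ∈ maximalIdeal A ^ k, a • x = 0) ∧
      ∀ j < k, ¬ ∀ a ∈ maximalIdeal A ^ j, a • x = 0 :=
    ⟨Nat.find hex, Nat.find_spec hex, fun j hj => Nat.find_min hex hj⟩
  cases k with
  | zero => exact absurd (by simpa using hk 1 (by simp)) hx
  | succ k =>
    have := hmin k k.lt_succ_self
    push Not at this
    obtain ⟨c, hc, hcx⟩ := this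
    refine ⟨c, hcx, fun a ha => ?_⟩
    rw [smul_smul]
    exact hk _ (by rw [pow_succ']; exact Ideal.mul_mem_mul ha hc)

variable (A) in
/-- An injective module with simple essential socle over a local ring with nilpotent maximal
ideal: an injective hull of the residue field. -/
lemma exists_injective_hull_residueField (hA : IsNilpotent (maximalIdeal A)) :
    ∃ (E : Type u) (_ : AddCommGroup E) (_ : Module A E) (v : E), Module.Injective A E ∧ v ≠ 0 ∧
      (∀ a ∈ maximalIdeal A, a • v = 0) ∧
      ∀ e : E, (∀ a ∈ maximalIdeal A, a • e = 0) → ∃ c : A, e = c • v := by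
  obtain ⟨⟨E₀, hinj, ι, hι⟩⟩ := EnoughInjectives.presentation (ModuleCat.of A (ResidueField A))
  have hE₀ : Module.Injective A E₀ := Module.injective_module_of_injective_object A E₀
  have hf : Function.Injective ι.hom := (ModuleCat.mono_iff_injective ι).mp hι
  let v : E₀ := ι.hom (1 : ResidueField A)
  have hv0 : v ≠ 0 := fun h => one_ne_zero (hf (h.trans (map_zero ι.hom).symm))
  have hmv : ∀ a ∈ maximalIdeal A, a • v = 0 := fun a ha => by
    have h : a • (1 : ResidueField A) = 0 := by
      rw [Algebra.smul_def, mul_one]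
      exact (residue_eq_zero_iff a).mpr ha
    have := map_smul ι.hom a (1 : ResidueField A)
    rw [h, map_zero] at this
    exact this.symm
  -- a submodule containing `v` whose socle is generated by `v`
  let good : Set (Submodule A E₀) := {E | v ∈ E ∧
    ∀ e ∈ E, (∀ a ∈ maximalIdeal A, a • e = 0) → ∃ c : A, e = c • v}
  have hspan : Submodule.span A {v} ∈ good :=
    ⟨Submodule.mem_span_singleton_self v, fun e he _ => by
      obtain ⟨c, rfl⟩ := Submodule.mem_span_singleton.mp he
      exact ⟨c, rfl⟩⟩
  obtain ⟨E, -, hE⟩ := zorn_le_nonempty₀ good (fun C hC hch E₁ hE₁ => by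
    refine ⟨sSup C, ⟨?_, ?_⟩, fun s hs => le_sSup hs⟩
    · exact (le_sSup hE₁ : E₁ ≤ sSup C) (hC hE₁).1
    · intro e he
      obtain ⟨s, hs, hes⟩ := (Submodule.mem_sSup_of_directed ⟨E₁, hE₁⟩ hch.directedOn).mp he
      exact (hC hs).2 e hes) _ hspan
  -- `E` will be a retract of `E₀`, hence injective. `W`, maximal among submodules avoiding `v`, is
  -- the complement: `E` embeds in `E₀ ⧸ W`, and its inclusion into `E₀` extends to an injective map
  -- `g` on `E₀ ⧸ W`.
  obtain ⟨W, -, hW⟩ := zorn_le_nonempty₀ {W : Submodule A E₀ | v ∉ W}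
    (fun C hC hch W₁ hW₁ => by
      refine ⟨sSup C, fun h => ?_, fun s hs => le_sSup hs⟩
      obtain ⟨s, hs, hvs⟩ := (Submodule.mem_sSup_of_directed ⟨W₁, hW₁⟩ hch.directedOn).mp h
      exact hC hs hvs) ⊥ (by simpa using hv0)
  have unit_of_smul {c : A} {e : E₀} (h : c • e ≠ 0) (he : ∀ a ∈ maximalIdeal A, a • e = 0) :
      IsUnit c := by
    by_contra hc
    exact h (he c ((mem_maximalIdeal c).mpr hc))
  have hEW : Disjoint E W := by
    rw [Submodule.disjoint_def]
    intro e heE heW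
    by_contra he
    obtain ⟨c, hc0, hc⟩ := exists_smul_ne_zero_of_isNilpotent_maximalIdeal hA he
    obtain ⟨b, hb⟩ := hE.1.2 _ (E.smul_mem c heE) hc
    rw [hb] at hc0
    obtain ⟨b', hb'⟩ := (unit_of_smul hc0 hmv).exists_left_inv
    apply hW.1
    have : v = b' • c • e := by rw [hb, smul_smul, hb', one_smul]
    rw [this]
    exact W.smul_mem _ (W.smul_mem _ heW)
  -- the socle of `E₀ ⧸ W` is generated by the class of `v`
  have hsoc : ∀ e : E₀, (∀ a ∈ maximalIdeal A, a • e ∈ W) → ∃ c : A, e - c • v ∈ W := by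
    intro e he
    by_cases heW : e ∈ W
    · exact ⟨0, by simpa using heW⟩
    have : v ∈ W ⊔ Submodule.span A {e} := by
      by_contra h
      exact heW ((hW.2 h le_sup_left : W ⊔ Submodule.span A {e} ≤ W)
        (le_sup_right (a := W) (Submodule.mem_span_singleton_self e)))
    obtain ⟨w, hw, y, hy, hwy⟩ := Submodule.mem_sup.mp this
    obtain ⟨b, rfl⟩ := Submodule.mem_span_singleton.mp hy
    have hb : IsUnit b := by
      by_contra hb
      exact hW.1 (hwy ▸ W.add_mem hw (he b ((mem_maximalIdeal b).mpr hb)))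
    obtain ⟨b', hb'⟩ := hb.exists_left_inv
    refine ⟨b', ?_⟩
    rw [← hwy, smul_add, smul_smul, hb', one_smul]
    simpa using W.smul_mem b' hw
  obtain ⟨g, hg⟩ := Module.Injective.extension_property A E₀ E (E₀ ⧸ W)
    (W.mkQ ∘ₗ E.subtype) (by
      rw [← LinearMap.ker_eq_bot, LinearMap.ker_eq_bot']
      intro e he
      have : (e : E₀) ∈ W := by simpa using he
      exact Subtype.ext ((Submodule.disjoint_def.mp hEW) e e.2 this)) E.subtype
  have hgE : ∀ e ∈ E, g (W.mkQ e) = e := fun e he => LinearMap.congr_fun hg ⟨e, he⟩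
  have hmk : ∀ e, W.mkQ e = 0 ↔ e ∈ W := fun e => Submodule.Quotient.mk_eq_zero W
  have hginj : Function.Injective g := by
    rw [← LinearMap.ker_eq_bot, LinearMap.ker_eq_bot']
    intro q hq
    by_contra hq0
    obtain ⟨c, hc0, hc⟩ := exists_smul_ne_zero_of_isNilpotent_maximalIdeal hA hq0
    obtain ⟨e, he⟩ := W.mkQ_surjective (c • q)
    obtain ⟨b, hb⟩ := hsoc e (fun a ha => by
      have := hc a ha
      rw [← he, ← map_smul] at this
      exact (hmk _).mp this)
    have heb : W.mkQ e = W.mkQ (b • v) := by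
      rw [← sub_eq_zero, ← map_sub]; exact (hmk _).mpr hb
    have : g (c • q) = b • v := by rw [← he, heb, hgE _ (E.smul_mem b hE.1.1)]
    rw [map_smul, hq, smul_zero] at this
    rw [← he, heb, ← this, map_zero] at hc0
    exact hc0 rfl
  -- The range of `g` contains `E` and its socle is still generated by `v`, so maximality of `E`
  -- applies.
  have hrange : LinearMap.range g ≤ E := by
    refine hE.2 ⟨⟨W.mkQ v, hgE v hE.1.1⟩, ?_⟩ (fun e he => ⟨W.mkQ e, hgE e he⟩)
    rintro _ ⟨q, rfl⟩ hq
    obtain ⟨e, rfl⟩ := W.mkQ_surjective q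
    obtain ⟨b, hb⟩ := hsoc e (fun a ha => by
      have := hq a ha
      rw [← map_smul, ← map_zero g] at this
      have := hginj this
      rw [← map_smul] at this
      exact (hmk _).mp this)
    refine ⟨b, ?_⟩
    have heb : W.mkQ e = W.mkQ (b • v) := by
      rw [← sub_eq_zero, ← map_sub]; exact (hmk _).mpr hb
    rw [heb, hgE _ (E.smul_mem b hE.1.1)]
  let π : E₀ →ₗ[A] E := LinearMap.codRestrict E (g ∘ₗ W.mkQ) (fun e => hrange ⟨_, rfl⟩)
  have hπ : ∀ e : E, π e = e := fun e => Subtype.ext (hgE e e.2)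
  refine ⟨E, inferInstance, inferInstance, ⟨v, hE.1.1⟩, ⟨fun X Y _ _ _ _ f hf φ => ?_⟩, ?_, ?_, ?_⟩
  · obtain ⟨h, hh⟩ := hE₀.out f hf (E.subtype ∘ₗ φ)
    refine ⟨π ∘ₗ h, fun x => ?_⟩
    rw [LinearMap.comp_apply, hh x]
    exact hπ _
  · exact fun h => hv0 (congrArg Subtype.val h)
  · exact fun a ha => Subtype.ext (hmv a ha)
  · intro e he
    obtain ⟨c, hc⟩ := hE.1.2 e e.2 (fun a ha => congrArg Subtype.val (he a ha))
    exact ⟨c, Subtype.ext hc⟩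

omit [IsLocalRing A] in
/-- An element of an injective module that is killed by the annihilator of a finitely generated
ideal `I` lies in the product of `I` with the module. -/
lemma mem_ideal_smul_top_of_injective {E : Type u} [AddCommGroup E] [Module A E]
    [Module.Injective A E] {I : Ideal A} (hI : I.FG) {e : E}
    (he : ∀ a : A, (∀ i ∈ I, i * a = 0) → a • e = 0) : e ∈ I • (⊤ : Submodule A E) := by
  classical
  obtain ⟨s, rfl⟩ := hI
  -- The kernel of `f` is the annihilator of `I`, so `a ↦ a • e` factors through the image of `f`
  -- and extends to all of `s → A`. Then `e` is the value at `f 1`, the vector of generators.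
  let f : A →ₗ[A] (s → A) := LinearMap.pi fun i => LinearMap.mulLeft A (i : A)
  have hker : LinearMap.ker f ≤ LinearMap.ker (LinearMap.toSpanSingleton A E e) := by
    intro a ha
    rw [LinearMap.mem_ker] at ha ⊢
    refine he a fun i hi => ?_
    induction hi using Submodule.span_induction with
    | mem x hx => exact congrFun ha ⟨x, hx⟩
    | zero => simp
    | add x y _ _ hx hy => rw [add_mul, hx, hy, add_zero]
    | smul c x _ hx => rw [smul_mul_assoc, hx, smul_zero]
  obtain ⟨h, hh⟩ := Module.Injective.extension_property A E (A ⧸ LinearMap.ker f) (s → A)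
    ((LinearMap.ker f).liftQ f le_rfl)
    (LinearMap.ker_eq_bot.mp (Submodule.ker_liftQ_eq_bot' _ _ rfl))
    ((LinearMap.ker f).liftQ _ hker)
  have h1 := LinearMap.congr_fun hh ((LinearMap.ker f).mkQ 1)
  simp only [LinearMap.comp_apply, Submodule.mkQ_apply, Submodule.liftQ_apply,
    LinearMap.toSpanSingleton_apply, one_smul] at h1
  rw [← h1, pi_eq_sum_univ (f 1), map_sum]
  refine Submodule.sum_mem _ fun i _ => ?_
  rw [map_smul]
  refine Submodule.smul_mem_smul ?_ trivial
  simpa [f] using Ideal.subset_span i.2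

/-- Modulo the elements killed by `z₁, …, z_r`, elements of the socle, a module with simple socle
is generated by `r` elements. -/
lemma exists_fin_generators_mod_annihilated {E : Type*} [AddCommGroup E] [Module A E] {v : E}
    (hv : ∀ a ∈ maximalIdeal A, a • v = 0)
    (hE : ∀ e : E, (∀ a ∈ maximalIdeal A, a • e = 0) → ∃ c : A, e = c • v) {r : ℕ}
    (z : Fin r → A) (hz : ∀ j, ∀ a ∈ maximalIdeal A, a * z j = 0) (P : Submodule A E) :
    ∃ s : Fin r → E, (∀ i, s i ∈ P) ∧ ∀ e ∈ P,
      ∃ c : Fin r → A, ∀ j, z j • (e - ∑ i, c i • s i) = 0 := by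
  induction r generalizing P with
  | zero => exact ⟨Fin.elim0, fun i => i.elim0, fun e _ => ⟨Fin.elim0, fun j => j.elim0⟩⟩
  | succ r ih =>
    have hzv : ∀ j (e : E), ∃ c : A, z j • e = c • v := fun j e => hE _ fun a ha => by
      rw [smul_smul, hz j a ha, zero_smul]
    -- `z 0` maps `P` into the line spanned by `v`, so one element `e₀` controls it. Recursing on `P
    -- ∩ ker (z 0)` ensures that later corrections do not disturb this.
    obtain ⟨e₀, he₀, h0⟩ : ∃ e₀ ∈ P, ∀ e ∈ P, ∃ c : A, z 0 • (e - c • e₀) = 0 := by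
      by_cases h0 : ∀ e ∈ P, z 0 • e = 0
      · exact ⟨0, P.zero_mem, fun e he => ⟨0, by simpa using h0 e he⟩⟩
      · push Not at h0
        obtain ⟨e₀, he₀, h0⟩ := h0
        refine ⟨e₀, he₀, fun e he => ?_⟩
        obtain ⟨b, hb⟩ := hzv 0 e₀
        obtain ⟨c, hc⟩ := hzv 0 e
        have hbu : IsUnit b := by
          by_contra hbu
          exact h0 (hb.trans (hv b ((mem_maximalIdeal b).mpr hbu)))
        obtain ⟨b', hb'⟩ := hbu.exists_left_inv
        refine ⟨c * b', ?_⟩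
        rw [smul_sub, smul_comm, hb, hc, smul_smul, mul_assoc, hb', mul_one, sub_self]
    obtain ⟨s, hsP, hs⟩ := ih (fun j => z j.succ) (fun j => hz j.succ)
      (P ⊓ LinearMap.ker (LinearMap.lsmul A E (z 0)))
    refine ⟨Fin.cons e₀ s, Fin.cases he₀ fun i => (hsP i).1, fun e he => ?_⟩
    obtain ⟨c₀, hc₀⟩ := h0 e he
    obtain ⟨c, hc⟩ := hs (e - c₀ • e₀) ⟨P.sub_mem he (P.smul_mem _ he₀), hc₀⟩
    have hs0 : ∀ i, z 0 • s i = 0 := fun i => (hsP i).2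
    refine ⟨Fin.cons c₀ c, Fin.cases ?_ fun j => ?_⟩
    · simp only [Fin.sum_univ_succ, Fin.cons_zero, Fin.cons_succ]
      rw [← sub_sub, smul_sub, hc₀, Finset.smul_sum, zero_sub, neg_eq_zero]
      exact Finset.sum_eq_zero fun i _ => by rw [smul_comm, hs0, smul_zero]
    · simp only [Fin.sum_univ_succ, Fin.cons_zero, Fin.cons_succ]
      rw [← sub_sub]
      exact hc j

/-- Let `A` be an Artinian local ring whose socle is generated by `r` elements. If `x` is killed by
the annihilator of an ideal `I`, then `x` satisfies an equation of integral dependence on `I` of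
degree `r`. -/
lemma exists_pow_eq_sum_of_mul_annihilator_eq_zero [IsNoetherianRing A]
    (hA : IsNilpotent (maximalIdeal A)) {r : ℕ} {z : Fin r → A}
    (hz : ∀ j, ∀ a ∈ maximalIdeal A, a * z j = 0)
    (hzspan : ∀ b : A, (∀ a ∈ maximalIdeal A, a * b = 0) → b ∈ Ideal.span (Set.range z))
    {I : Ideal A} {x : A} (hx : ∀ a : A, (∀ i ∈ I, i * a = 0) → a * x = 0) :
    ∃ c : Fin r → A, (∀ i : Fin r, c i ∈ I ^ (r - (i : ℕ))) ∧ x ^ r = ∑ i, c i * x ^ (i : ℕ) := by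
  obtain ⟨E, _, _, v, hinj, hv0, hv, hE⟩ := exists_injective_hull_residueField A hA
  obtain ⟨s, -, hs⟩ := exists_fin_generators_mod_annihilated hv hE z hz ⊤
  -- `E` is generated by `s`
  have hgen : ⊤ ≤ Submodule.span A (Set.range s) := by
    -- The remainder is killed by every `z j`, hence by the whole socle, the annihilator of the
    -- maximal ideal; injectivity puts it in the maximal ideal times `E`.
    have h1 : ⊤ ≤ Submodule.span A (Set.range s) ⊔ maximalIdeal A • (⊤ : Submodule A E) := by
      intro e _
      obtain ⟨c, hc⟩ := hs e trivial
      rw [← add_sub_cancel (∑ i, c i • s i) e]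
      refine Submodule.add_mem_sup (Submodule.sum_mem _ fun i _ => Submodule.smul_mem _ _
        (Submodule.subset_span ⟨i, rfl⟩)) ?_
      refine mem_ideal_smul_top_of_injective (IsNoetherian.noetherian _) fun a ha => ?_
      refine (Ideal.span_le (I := LinearMap.ker (LinearMap.toSpanSingleton A E
        (e - ∑ i, c i • s i)))).mpr ?_ (hzspan a ha)
      rintro _ ⟨j, rfl⟩
      exact hc j
    -- Nakayama by iteration: nilpotency stands in for finite generation of `E`, not yet known.
    obtain ⟨N, hN⟩ := hA
    have h2 : ∀ k, ⊤ ≤ Submodule.span A (Set.range s) ⊔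
        maximalIdeal A ^ k • (⊤ : Submodule A E) := by
      intro k
      induction k with
      | zero => simp
      | succ k ih =>
        refine h1.trans (sup_le le_sup_left ?_)
        refine (Submodule.smul_mono le_rfl ih).trans ?_
        rw [Submodule.smul_sup, ← mul_smul, ← pow_succ']
        exact sup_le_sup_right Submodule.smul_le_right _
    simpa [hN] using h2 N
  have hfaithful : ∀ a : A, (∀ e : E, a • e = 0) → a = 0 := by
    intro a ha
    by_contra ha0
    obtain ⟨c, hc0, hc⟩ := exists_smul_ne_zero_of_isNilpotent_maximalIdeal hA ha0
    -- The ideal generated by the socle element `c • a` maps to `E` with `c • a ↦ v`. Extending this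
    -- map to `A` writes `v` as a multiple of `a • h 1`.
    let f : A →ₗ[A] A := LinearMap.toSpanSingleton A A (c • a)
    have hf : LinearMap.ker f ≤ maximalIdeal A := by
      intro b hb
      rw [mem_maximalIdeal]
      intro hbu
      exact hc0 (hbu.smul_eq_zero.mp (show b • c • a = 0 from hb))
    obtain ⟨h, hh⟩ := Module.Injective.extension_property A E (A ⧸ LinearMap.ker f) A
      ((LinearMap.ker f).liftQ f le_rfl)
      (LinearMap.ker_eq_bot.mp (Submodule.ker_liftQ_eq_bot' _ _ rfl))
      ((LinearMap.ker f).liftQ (LinearMap.toSpanSingleton A E v) fun b hb => hv b (hf hb))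
    have h1 := LinearMap.congr_fun hh ((LinearMap.ker f).mkQ 1)
    simp only [LinearMap.comp_apply, Submodule.mkQ_apply, Submodule.liftQ_apply] at h1
    have h2 : f 1 = c • a • (1 : A) := by simp [f]
    rw [h2, map_smul, map_smul, ha, smul_zero] at h1
    exact hv0 ((one_smul A v).symm.trans h1.symm)
  have hfin : Module.Finite A E := ⟨by
    rw [← top_le_iff.mp hgen]; exact Submodule.fg_span (Set.finite_range s)⟩
  have hrank : (⊤ : Submodule A E).spanFinrank ≤ r := by
    rw [← top_le_iff.mp hgen]
    refine (Submodule.spanFinrank_span_le_ncard_of_finite (Set.finite_range s)).trans ?_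
    rw [← Nat.card_coe_set_eq]
    simpa using Finite.card_range_le s
  obtain ⟨p, hp, hdeg, hcoeff, hpx⟩ :=
    LinearMap.exists_monic_and_natDegree_eq_and_coeff_mem_pow_and_aeval_eq_zero A
      (LinearMap.lsmul A E x) I (by
        rintro _ ⟨e, rfl⟩
        refine mem_ideal_smul_top_of_injective (IsNoetherian.noetherian _) fun a ha => ?_
        rw [LinearMap.lsmul_apply, smul_smul, hx a ha, zero_smul])
  have hpx0 : p.eval x = 0 := hfaithful _ fun e => by
    have h := Polynomial.aeval_algebraMap_apply_eq_algebraMap_eval (A := Module.End A E) x p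
    have h' : algebraMap A (Module.End A E) x = LinearMap.lsmul A E x := rfl
    rw [h', hpx] at h
    exact (LinearMap.congr_fun h e).symm
  rw [← hdeg] at hrank
  -- Cayley–Hamilton gives degree `spanFinrank`, at most `r`; the factor `X ^ t` makes the degree
  -- exactly `r`.
  obtain ⟨t, rfl⟩ := Nat.exists_eq_add_of_le hrank
  let q := p * Polynomial.X ^ t
  have hqm : q.Monic := hp.mul (Polynomial.monic_X_pow t)
  have hqd : q.natDegree = p.natDegree + t := by
    rw [hp.natDegree_mul (Polynomial.monic_X_pow t), Polynomial.natDegree_X_pow]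
  have hq0 : q.eval x = 0 := by simp [q, hpx0]
  refine ⟨fun i => - q.coeff i, fun i => ?_, ?_⟩
  · rw [neg_mem_iff, Polynomial.coeff_mul_X_pow']
    split_ifs with h
    · have := hcoeff (i - t)
      rwa [show p.natDegree - ((i : ℕ) - t) = p.natDegree + t - i by omega] at this
    · exact zero_mem _
  · rw [Polynomial.eval_eq_sum_range, hqd, Finset.sum_range_succ, ← hqd, hqm.coeff_natDegree,
      one_mul, hqd, Finset.sum_range] at hq0
    simp only [neg_mul, Finset.sum_neg_distrib]
    exact eq_neg_of_add_eq_zero_right hq0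

end ArtinianLocal

/-! ### Colon ideals and socles when a regular sequence is replaced by powers. -/

section PowersOfRegularSequences

variable {R : Type u} [CommRing R]

lemma mem_sup_span_singleton_iff {K : Ideal R} {a y : R} :
    y ∈ K ⊔ Ideal.span {a} ↔ ∃ c, y - c * a ∈ K := by
  rw [Submodule.mem_sup]
  constructor
  · rintro ⟨κ, hκ, b, hb, rfl⟩
    obtain ⟨c, rfl⟩ := Ideal.mem_span_singleton'.mp hb
    exact ⟨c, by simpa using hκ⟩
  · rintro ⟨c, hc⟩
    exact ⟨_, hc, c * a, Ideal.mem_span_singleton'.mpr ⟨c, rfl⟩, by ring⟩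

section Colon

variable {K : Ideal R} {a : R} (ha : ∀ y, a * y ∈ K → y ∈ K)

include ha

lemma mem_of_pow_mul_mem (k : ℕ) {y : R} (hy : a ^ k * y ∈ K) : y ∈ K := by
  induction k generalizing y with
  | zero => simpa using hy
  | succ k ih => exact ha _ (ih (by rwa [pow_succ, mul_assoc] at hy))

lemma exists_sub_pow_mul_mem_of_mul_mem {k : ℕ} {y : R}
    (hy : a * y ∈ K ⊔ Ideal.span {a ^ (k + 1)}) : ∃ w, y - a ^ k * w ∈ K := by
  obtain ⟨c, hc⟩ := mem_sup_span_singleton_iff.mp hy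
  refine ⟨c, ha _ ?_⟩
  convert! hc using 1
  ring

lemma mem_sup_span_of_pow_mul_mem {k : ℕ} {y : R}
    (hy : a ^ k * y ∈ K ⊔ Ideal.span {a ^ (k + 1)}) : y ∈ K ⊔ Ideal.span {a} := by
  obtain ⟨c, hc⟩ := mem_sup_span_singleton_iff.mp hy
  refine mem_sup_span_singleton_iff.mpr ⟨c, mem_of_pow_mul_mem ha k ?_⟩
  convert! hc using 1
  ring

omit ha in
lemma pow_mul_mem_sup_span {k : ℕ} {y : R} (hy : y ∈ K ⊔ Ideal.span {a}) :
    a ^ k * y ∈ K ⊔ Ideal.span {a ^ (k + 1)} := by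
  obtain ⟨c, hc⟩ := mem_sup_span_singleton_iff.mp hy
  refine mem_sup_span_singleton_iff.mpr ⟨c, ?_⟩
  convert! K.mul_mem_left (a ^ k) hc using 1
  ring

/-- Since `a ∈ N`, cancelling `a` modulo `K` makes `y` a multiple `a ^ k * w`; cancelling `a ^ k`
then bounds `w`. So multiplication by `a ^ k` carries the colon of `N` for exponent 1 onto that for
exponent `k + 1`, modulo `K`. -/
lemma exists_eq_pow_mul_add_of_mul_mem {N : Ideal R} (haN : a ∈ N) {k : ℕ} {y : R}
    (hy : ∀ i ∈ N, i * y ∈ K ⊔ Ideal.span {a ^ (k + 1)}) :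
    ∃ w, (∀ i ∈ N, i * w ∈ K ⊔ Ideal.span {a}) ∧ y - a ^ k * w ∈ K := by
  obtain ⟨w, hw⟩ := exists_sub_pow_mul_mem_of_mul_mem ha (hy a haN)
  refine ⟨w, fun i hi => mem_sup_span_of_pow_mul_mem ha (k := k) ?_, hw⟩
  have h1 : i * (y - a ^ k * w) ∈ K ⊔ Ideal.span {a ^ (k + 1)} :=
    Ideal.mul_mem_left _ _ (le_sup_left (a := K) hw)
  convert! sub_mem (hy i hi) h1 using 1
  ring

end Colon

/-- The ideal `J` is primary to the maximal ideal, its socle modulo `J` is generated by `r`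
elements, and `x` multiplies `J : I` into `J`. -/
structure SocleBounded [IsLocalRing R] (I : Ideal R) (x : R) (r : ℕ) (J : Ideal R) : Prop where
  radical_eq : J.radical = maximalIdeal R
  exists_socle : ∃ z : Fin r → R, (∀ j, ∀ i ∈ maximalIdeal R, i * z j ∈ J) ∧
    ∀ y, (∀ i ∈ maximalIdeal R, i * y ∈ J) → y ∈ Ideal.span (Set.range z) ⊔ J
  mul_mem : ∀ y, (∀ i ∈ I, i * y ∈ J) → x * y ∈ J

/-- The preceding colon computation with the maximal ideal turns socle generators `z j` into `a ^ k
* z j`, so `r` is unchanged; with `I` it transports the condition on `x`. -/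
lemma SocleBounded.sup_span_pow [IsLocalRing R] {I : Ideal R} {x : R} {r : ℕ} {K : Ideal R} {a : R}
    (ha : ∀ y, a * y ∈ K → y ∈ K) (haI : a ∈ I) (k : ℕ)
    (h : SocleBounded I x r (K ⊔ Ideal.span {a})) :
    SocleBounded I x r (K ⊔ Ideal.span {a ^ (k + 1)}) where
  radical_eq := by
    rw [← h.radical_eq, Ideal.radical_sup, ← Ideal.span_singleton_pow,
      Ideal.radical_pow _ k.succ_ne_zero, ← Ideal.radical_sup]
  exists_socle := by
    obtain ⟨z, hz, hspan⟩ := h.exists_socle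
    have ham : a ∈ maximalIdeal R := by
      rw [← h.radical_eq]
      exact Ideal.le_radical (le_sup_right (a := K) (Ideal.mem_span_singleton_self a))
    refine ⟨fun j => a ^ k * z j, fun j i hi => ?_, fun y hy => ?_⟩
    · rw [mul_left_comm]
      exact pow_mul_mem_sup_span (hz j i hi)
    · obtain ⟨w, hw, hyw⟩ := exists_eq_pow_mul_add_of_mul_mem ha ham hy
      obtain ⟨s, hs, t, ht, rfl⟩ := Submodule.mem_sup.mp (hspan w hw)
      have h1 : a ^ k * s ∈ Ideal.span (Set.range fun j => a ^ k * z j) := by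
        obtain ⟨c, rfl⟩ := (Submodule.mem_span_range_iff_exists_fun R).mp hs
        rw [Finset.mul_sum]
        refine sum_mem fun j _ => ?_
        rw [smul_eq_mul, mul_left_comm]
        exact Ideal.mul_mem_left _ _ (Ideal.subset_span ⟨j, rfl⟩)
      rw [show y = a ^ k * s + (a ^ k * t + (y - a ^ k * (s + t))) by ring]
      exact Submodule.add_mem_sup h1 (add_mem (pow_mul_mem_sup_span ht) (le_sup_left (a := K) hyw))
  mul_mem := fun y hy => by
    obtain ⟨w, hw, hyw⟩ := exists_eq_pow_mul_add_of_mul_mem ha haI hy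
    rw [show x * y = a ^ k * (x * w) + x * (y - a ^ k * w) by ring]
    exact add_mem (pow_mul_mem_sup_span (h.mul_mem w hw))
      (Ideal.mul_mem_left _ _ (le_sup_left (a := K) hyw))

open RingTheory.Sequence

lemma isRegular_mem_maximalIdeal [IsLocalRing R] {rs : List R} (h : IsRegular R rs) :
    ∀ a ∈ rs, a ∈ maximalIdeal R := by
  intro a ha
  refine le_maximalIdeal (J := Ideal.ofList rs) (fun htop => h.top_ne_smul ?_)
    (Ideal.subset_span ha)
  rw [htop, Submodule.top_smul]

lemma isRegular_append_singleton_iff [IsLocalRing R] {rs : List R} {a : R}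
    (hm : ∀ b ∈ rs ++ [a], b ∈ maximalIdeal R) :
    IsRegular R (rs ++ [a]) ↔
      IsWeaklyRegular R rs ∧ ∀ y, a * y ∈ Ideal.ofList rs → y ∈ Ideal.ofList rs := by
  rw [IsLocalRing.isRegular_iff_isWeaklyRegular_of_subset_maximalIdeal hm,
    isWeaklyRegular_append_iff, isWeaklyRegular_singleton_iff,
    isSMulRegular_quotient_iff_mem_of_smul_mem]
  simp

lemma isRegular_append_singleton_pow [IsLocalRing R] {rs : List R} {a : R}
    (h : IsRegular R (rs ++ [a])) (k : ℕ) : IsRegular R (rs ++ [a ^ (k + 1)]) := by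
  have hm := isRegular_mem_maximalIdeal h
  obtain ⟨h1, h2⟩ := (isRegular_append_singleton_iff hm).mp h
  refine (isRegular_append_singleton_iff ?_).mpr ⟨h1, fun y => mem_of_pow_mul_mem h2 (k + 1)⟩
  intro b hb
  rcases List.mem_append.mp hb with hb | hb
  · exact hm b (List.mem_append_left _ hb)
  · rw [List.mem_singleton.mp hb]
    exact Ideal.pow_mem_of_mem _ (hm a (by simp)) _ k.succ_pos

/-- A property of ideals that survives the replacement of one element of a regular sequence by
a power of it survives the replacement of all elements by their powers. -/
lemma isRegular_map_pow_and [IsLocalRing R] [IsNoetherianRing R] (k : ℕ) {S : Set R}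
    {P : Ideal R → Prop} (hP : ∀ (K : Ideal R) (a : R), (∀ y, a * y ∈ K → y ∈ K) → a ∈ S →
      P (K ⊔ Ideal.span {a}) → P (K ⊔ Ideal.span {a ^ (k + 1)}))
    (l₁ l₂ : List R) (hS : ∀ a ∈ l₁, a ∈ S) (h : IsRegular R (l₁ ++ l₂))
    (hl : P (Ideal.ofList (l₁ ++ l₂))) :
    IsRegular R (l₂ ++ l₁.map (· ^ (k + 1))) ∧
      P (Ideal.ofList (l₂ ++ l₁.map (· ^ (k + 1)))) := by
  induction l₁ generalizing l₂ with
  | nil => simpa using And.intro h hl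
  | cons a l₁ ih =>
    -- Regular sequences in a Noetherian local ring are permutable, so the head moves to the end,
    -- where it is a nonzerodivisor modulo the rest. `l₂` collects the elements already raised to
    -- powers.
    have hperm : List.Perm (a :: l₁ ++ l₂) ((l₁ ++ l₂) ++ [a]) := by
      simpa using (List.perm_append_comm (l₁ := [a]) (l₂ := l₁ ++ l₂))
    have h1 : IsRegular R ((l₁ ++ l₂) ++ [a]) := IsLocalRing.isRegular_of_perm h hperm
    have hl1 : P (Ideal.ofList (l₁ ++ l₂) ⊔ Ideal.span {a}) := by
      convert! hl using 1
      simp [sup_comm]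
    have h2 := isRegular_append_singleton_pow h1 k
    have hl2 := hP _ a ((isRegular_append_singleton_iff (isRegular_mem_maximalIdeal h1)).mp h1).2
      (hS a (by simp)) hl1
    have := ih (l₂ ++ [a ^ (k + 1)]) (fun b hb => hS b (by simp [hb])) (by simpa using h2)
      (by convert! hl2 using 1; simp [sup_assoc])
    simpa using this

lemma isRegular_map_pow [IsLocalRing R] [IsNoetherianRing R] {rs : List R} (h : IsRegular R rs)
    (k : ℕ) : IsRegular R (rs.map (· ^ (k + 1))) :=
  (isRegular_map_pow_and k (S := Set.univ) (P := fun _ => True) (fun _ _ _ _ _ => trivial) rs []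
    (fun _ _ => trivial) (by simpa using h) trivial).1

end PowersOfRegularSequences

/-! ### From equations modulo powers to integral dependence in `R`. -/

section IntegralDependence

variable {R : Type u} [CommRing R]

lemma mem_idealIntegralClosure_of_pow_eq_sum [Nontrivial R] {I : Ideal R} {x : R} {r : ℕ}
    {c : Fin r → R}
    (hc : ∀ i : Fin r, c i ∈ I ^ (r - (i : ℕ))) (hx : x ^ r = ∑ i, c i * x ^ (i : ℕ)) :
    x ∈ idealIntegralClosure I := by
  let q : Polynomial R := ∑ i, Polynomial.C (c i) * Polynomial.X ^ (i : ℕ)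
  have hq : q.degree < r := by
    refine (Polynomial.degree_sum_le _ _).trans_lt ((Finset.sup_lt_iff (WithBot.bot_lt_coe r)).mpr
      fun i _ => (Polynomial.degree_C_mul_X_pow_le _ _).trans_lt ?_)
    exact Nat.cast_lt.mpr i.2
  have hdeg : (Polynomial.X ^ r - q).natDegree = r :=
    Polynomial.natDegree_eq_of_degree_eq_some (by
      rw [Polynomial.degree_sub_eq_left_of_degree_lt (by simpa using hq), Polynomial.degree_X_pow])
  refine ⟨Polynomial.X ^ r - q, Polynomial.monic_X_pow_sub hq, ?_, fun i => ?_⟩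
  · simp [q, Polynomial.eval_finsetSum, hx]
  · rw [hdeg, Polynomial.coeff_sub]
    refine sub_mem ?_ ?_
    · rw [Polynomial.coeff_X_pow]
      split_ifs with h
      · simp [h]
      · exact zero_mem _
    · rw [Polynomial.finsetSum_coeff]
      refine sum_mem fun j _ => ?_
      rw [Polynomial.coeff_C_mul_X_pow]
      split_ifs with h
      · rw [h]; exact hc j
      · exact zero_mem _

lemma one_notMem_idealIntegralClosure {I : Ideal R} (hI : I ≠ ⊤) :
    (1 : R) ∉ idealIntegralClosure I := by
  rintro ⟨p, hp, h0, hc⟩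
  apply (Ideal.ne_top_iff_one I).mp hI
  rw [Polynomial.eval_eq_sum_range, Finset.sum_range_succ, hp.coeff_natDegree] at h0
  simp only [one_pow, mul_one] at h0
  rw [eq_neg_of_add_eq_zero_right h0, neg_mem_iff]
  refine sum_mem fun i hi => Ideal.pow_le_self ?_ (hc i)
  have := Finset.mem_range.mp hi
  omega

variable [IsLocalRing R] [IsNoetherianRing R]

/-- Krull's intersection theorem for the module `R ⧸ T`. -/
lemma mem_of_forall_mem_sup_maximalIdeal_pow {T : Ideal R} {y : R}
    (h : ∀ k, y ∈ T ⊔ maximalIdeal R ^ (k + 1)) : y ∈ T := by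
  rw [← Submodule.Quotient.mk_eq_zero, ← Submodule.mem_bot R,
    ← Ideal.iInf_pow_smul_eq_bot_of_isLocalRing (M := R ⧸ T) (maximalIdeal R)
      (Ideal.IsPrime.ne_top inferInstance), Submodule.mem_iInf]
  intro k
  refine Submodule.smul_mono_left (Ideal.pow_le_pow_right k.le_succ) ?_
  obtain ⟨t, ht, w, hw, rfl⟩ := Submodule.mem_sup.mp (h k)
  have : (Submodule.Quotient.mk (t + w) : R ⧸ T) = w • Submodule.Quotient.mk (1 : R) := by
    rw [← Submodule.Quotient.mk_smul, smul_eq_mul, mul_one, Submodule.Quotient.eq]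
    simpa using ht
  rw [this]
  exact Submodule.smul_mem_smul hw trivial

/-- `R ⧸ J` has nilpotent maximal ideal and socle generated by `r` elements, so the Artinian result
applies there; its coefficients lift to powers of `I`. -/
lemma SocleBounded.exists_pow_sub_sum_mem {I J : Ideal R} {x : R} {r : ℕ}
    (h : SocleBounded I x r J) :
    ∃ c : Fin r → R, (∀ i : Fin r, c i ∈ I ^ (r - (i : ℕ))) ∧
      x ^ r - ∑ i, c i * x ^ (i : ℕ) ∈ J := by
  have hJ : J ≤ maximalIdeal R := h.radical_eq ▸ Ideal.le_radical
  have hJtop : J ≠ ⊤ := fun htop => (maximalIdeal.isMaximal R).ne_top (top_le_iff.mp (htop ▸ hJ))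
  have : Nontrivial (R ⧸ J) := Ideal.Quotient.nontrivial_iff.mpr hJtop
  have hsurj : Function.Surjective (Ideal.Quotient.mk J) := Ideal.Quotient.mk_surjective
  have : IsLocalRing (R ⧸ J) := IsLocalRing.of_surjective' _ hsurj
  have hmax : maximalIdeal (R ⧸ J) = (maximalIdeal R).map (Ideal.Quotient.mk J) :=
    (map_maximalIdeal_of_surjective _ hsurj).symm
  have hmem : ∀ {N : Ideal R} {y : R}, (∀ b ∈ N.map (Ideal.Quotient.mk J),
      b * Ideal.Quotient.mk J y = 0) ↔ ∀ i ∈ N, i * y ∈ J := by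
    intro N y
    constructor
    · intro hb i hi
      rw [← Ideal.Quotient.eq_zero_iff_mem, map_mul]
      exact hb _ (Ideal.mem_map_of_mem _ hi)
    · intro hi b hb
      obtain ⟨i, hiN, rfl⟩ := (Ideal.mem_map_iff_of_surjective _ hsurj).mp hb
      rw [← map_mul, Ideal.Quotient.eq_zero_iff_mem]
      exact hi i hiN
  have hnil : IsNilpotent (maximalIdeal (R ⧸ J)) := by
    obtain ⟨N, hN⟩ := Ideal.exists_radical_pow_le_of_fg J (IsNoetherian.noetherian _)
    refine ⟨N, ?_⟩
    rw [hmax, ← Ideal.map_pow, ← h.radical_eq]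
    rw [Ideal.zero_eq_bot, ← le_bot_iff, ← Ideal.map_quotient_self J]
    exact Ideal.map_mono hN
  obtain ⟨z, hz, hspan⟩ := h.exists_socle
  obtain ⟨c, hc, hxc⟩ := exists_pow_eq_sum_of_mul_annihilator_eq_zero hnil
    (z := fun j => Ideal.Quotient.mk J (z j)) (I := I.map (Ideal.Quotient.mk J))
    (x := Ideal.Quotient.mk J x) (fun j => by rw [hmax]; exact hmem.mpr (hz j))
    (fun b hb => by
      obtain ⟨y, rfl⟩ := hsurj b
      rw [hmax] at hb
      have := Ideal.mem_map_of_mem (Ideal.Quotient.mk J) (hspan y (hmem.mp hb))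
      rwa [Ideal.map_sup, Ideal.map_quotient_self, sup_bot_eq, Ideal.map_span,
        ← Set.range_comp] at this)
    (fun b hb => by
      obtain ⟨y, rfl⟩ := hsurj b
      rw [← map_mul, Ideal.Quotient.eq_zero_iff_mem, mul_comm]
      exact h.mul_mem y (hmem.mp hb))
  have hlift : ∀ i : Fin r, ∃ b ∈ I ^ (r - (i : ℕ)), Ideal.Quotient.mk J b = c i := fun i =>
    (Ideal.mem_map_iff_of_surjective _ hsurj).mp (by rw [Ideal.map_pow]; exact hc i)
  choose b hb hbc using hlift
  refine ⟨b, hb, ?_⟩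
  rw [← Ideal.Quotient.eq_zero_iff_mem]
  simp [hbc, hxc]

/-- Let `J ⊆ I` be generated by a regular sequence and primary to the maximal ideal. If `x`
multiplies `J : I` into `J`, then `x` is integral over `I`. -/
theorem mem_idealIntegralClosure_of_mul_colon_le {I : Ideal R} {rs : List R}
    (hrs : RingTheory.Sequence.IsRegular R rs) (hI : ∀ a ∈ rs, a ∈ I)
    (hrad : (Ideal.ofList rs).radical = maximalIdeal R) {x : R}
    (hx : ∀ y, (∀ i ∈ I, i * y ∈ Ideal.ofList rs) → x * y ∈ Ideal.ofList rs) :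
    x ∈ idealIntegralClosure I := by
  have hmemcolon : ∀ y, y ∈ (Ideal.ofList rs).colon (maximalIdeal R : Set R) ↔
      ∀ i ∈ maximalIdeal R, i * y ∈ Ideal.ofList rs := fun y => by
    rw [Submodule.mem_colon]
    simp [mul_comm y]
  obtain ⟨r, z, hz⟩ := Submodule.fg_iff_exists_fin_generating_family.mp
    (IsNoetherian.noetherian ((Ideal.ofList rs).colon (maximalIdeal R : Set R)))
  have hS : SocleBounded I x r (Ideal.ofList rs) :=
    ⟨hrad, ⟨z, fun j => (hmemcolon _).mp (hz ▸ Submodule.subset_span ⟨j, rfl⟩),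
      fun y hy => le_sup_left (a := Ideal.span (Set.range z)) (hz.ge ((hmemcolon y).mpr hy))⟩, hx⟩
  -- `T` is the ideal ∑ I^{r-i} x^i, presented as an image so that membership returns the
  -- coefficients.
  let T : Ideal R := Submodule.map (Fintype.linearCombination R fun i : Fin r => x ^ (i : ℕ))
    (Submodule.pi Set.univ fun i => I ^ (r - (i : ℕ)))
  have hT : x ^ r ∈ T := mem_of_forall_mem_sup_maximalIdeal_pow fun k => by
    have hSk := (isRegular_map_pow_and k (S := I) (P := SocleBounded I x r)
      (fun K a ha haI hK => hK.sup_span_pow ha haI k) rs [] hI (by simpa using hrs)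
      (by simpa using hS)).2
    obtain ⟨c, hc, hxc⟩ := hSk.exists_pow_sub_sum_mem
    rw [← add_sub_cancel (∑ i, c i * x ^ (i : ℕ)) (x ^ r)]
    refine Submodule.add_mem_sup ⟨c, by simpa using hc, by simp [Fintype.linearCombination_apply]⟩
      ((Ideal.span_le.mpr ?_ : Ideal.ofList _ ≤ _) hxc)
    intro b hb
    obtain ⟨a, ha, rfl⟩ := List.mem_map.mp (by simpa using hb)
    exact Ideal.pow_mem_pow (isRegular_mem_maximalIdeal hrs a ha) _
  obtain ⟨c, hc, hxc⟩ := hT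
  refine mem_idealIntegralClosure_of_pow_eq_sum (c := c) (by simpa using hc) ?_
  rw [← hxc]
  simp [Fintype.linearCombination_apply]

end IntegralDependence

/-! ### Elementwise homology of short complexes of modules. -/

section ShortComplexHomology

variable {R : Type u} [CommRing R]

lemma exists_eq_smul_of_mem_annihilator_homology (S : ShortComplex (ModuleCat.{u} R)) {t : R}
    (ht : t ∈ Module.annihilator R S.homology) {z : S.X₂} (hz : S.g z = 0) :
    ∃ w, S.f w = t • z := by
  obtain ⟨c, hc⟩ : ∃ c : S.cycles, S.iCycles c = z :=
    ⟨S.moduleCatCyclesIso.inv ⟨z, hz⟩, by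
      have := S.moduleCatCyclesIso_inv_iCycles
      exact congr($this ⟨z, hz⟩)⟩
  have h1 : S.homologyι (S.homologyπ (t • c)) = 0 := by
    rw [map_smul, Module.mem_annihilator.mp ht, map_zero]
  have h2 : S.homologyι (S.homologyπ (t • c)) = S.pOpcycles (S.iCycles (t • c)) :=
    congr($(S.homology_π_ι) (t • c))
  rw [h2, S.moduleCat_pOpcycles_eq_zero_iff, map_smul, hc] at h1
  exact h1

lemma subsingleton_homology_of_forall_exists (S : ShortComplex (ModuleCat.{u} R))
    (h : ∀ z, S.g z = 0 → ∃ w, S.f w = z) : Subsingleton S.homology :=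
  ModuleCat.isZero_iff_subsingleton.mp
    ((S.exact_iff_isZero_homology).mp ((S.moduleCat_exact_iff).mpr h))

end ShortComplexHomology

/-! ### Koszul homology with coefficients in quotients of `R`. -/

section Koszul

variable {R : Type u} [CommRing R] {n : ℕ}

lemma mem_smul_top_iff_forall_repr {ι M : Type*} [AddCommGroup M] [Module R M]
    (b : Module.Basis ι R M) {K : Ideal R} {v : M} :
    v ∈ K • (⊤ : Submodule R M) ↔ ∀ i, b.repr v i ∈ K := by
  constructor
  · intro hv i
    have : b.coord i v ∈ K • (⊤ : Submodule R R) := by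
      have := Submodule.mem_map_of_mem (f := b.coord i) hv
      rw [Submodule.map_smul''] at this
      exact Submodule.smul_mono le_rfl le_top this
    simpa using this
  · intro h
    rw [← b.linearCombination_repr v]
    exact Submodule.sum_mem _ fun i _ => Submodule.smul_mem_smul (h i) trivial

lemma map_mem_smul_top {M N : Type*} [AddCommGroup M] [Module R M] [AddCommGroup N] [Module R N]
    (f : M →ₗ[R] N) {K : Ideal R} {v : M} (hv : v ∈ K • (⊤ : Submodule R M)) :
    f v ∈ K • (⊤ : Submodule R N) := by
  have := Submodule.mem_map_of_mem (f := f) hv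
  rw [Submodule.map_smul''] at this
  exact Submodule.smul_mono le_rfl le_top this

/-- The scalar `t` annihilates the `j`-th Koszul homology of `a` with coefficients in `R ⧸ K`. -/
def AnnihilatesKoszul (a : Fin n → R) (K : Ideal R) (j : ℕ) (t : R) : Prop :=
  ∀ z ∈ ⋀[R]^j (Fin n → R),
    koszulContract a z ∈ K • (⊤ : Submodule R (ExteriorAlgebra R (Fin n → R))) →
    ∃ u ∈ ⋀[R]^(j + 1) (Fin n → R),
      t • z - koszulContract a u ∈ K • (⊤ : Submodule R (ExteriorAlgebra R (Fin n → R)))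

lemma koszulHomology_differential_prev (a : Fin n → R) (i : ℕ) :
    (koszulChainComplex a).d (i + 1) i = ModuleCat.ofHom (koszulDifferential a i) := by
  exact ChainComplex.of_d (fun i => ModuleCat.of R (⋀[R]^i (Fin n → R)))
    (fun i => ModuleCat.ofHom (koszulDifferential a i)) i

/-- The Koszul homology as the homology of an explicit short complex. -/
noncomputable def koszulHomologyIso (a : Fin n → R) (i : ℕ) :
    koszulHomology a i ≅
      ((koszulChainComplex a).sc' (i + 1) i ((ComplexShape.down ℕ).next i)).homology :=
  (koszulChainComplex a).homologyIsoSc' _ _ _ (by simp) rfl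

lemma koszulDifferential_next_eq_zero_iff (a : Fin n → R) (i : ℕ)
    (z : ⋀[R]^i (Fin n → R)) :
    (koszulChainComplex a).d i ((ComplexShape.down ℕ).next i) z = 0 ↔
      koszulContract a z = 0 := by
  cases i with
  | zero =>
    -- `next 0` defaults to `0`, so the outgoing differential is zero by shape; the contraction also
    -- kills scalars.
    have h1 : (koszulChainComplex a).d 0 ((ComplexShape.down ℕ).next 0) z = 0 := by
      rw [(koszulChainComplex a).shape _ _ (by simp)]
      rfl
    refine iff_of_true h1 ?_
    obtain ⟨r, hr⟩ : ∃ r : R, algebraMap R _ r = z.1 := by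
      have h2 : z.1 ∈ LinearMap.range (ExteriorAlgebra.ι R (M := Fin n → R)) ^ 0 := z.2
      rw [pow_zero] at h2
      exact Submodule.mem_one.mp h2
    rw [← hr]
    exact CliffordAlgebra.contractLeft_algebraMap _ _ _
  | succ i =>
    rw [ChainComplex.next_nat_succ, koszulHomology_differential_prev]
    exact Subtype.ext_iff

lemma annihilatesKoszul_bot_of_mem_annihilator (a : Fin n → R) (i : ℕ) {t : R}
    (ht : t ∈ Module.annihilator R (koszulHomology a i)) : AnnihilatesKoszul a ⊥ i t := by
  intro z hz hdz
  rw [(koszulHomologyIso a i).toLinearEquiv.annihilator_eq] at ht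
  obtain ⟨w, hw⟩ := exists_eq_smul_of_mem_annihilator_homology _ ht (z := ⟨z, hz⟩)
    ((koszulDifferential_next_eq_zero_iff a i _).mpr (by simpa using hdz))
  refine ⟨(w : ⋀[R]^(i + 1) (Fin n → R)).1, (w : ⋀[R]^(i + 1) (Fin n → R)).2, ?_⟩
  have h2 : (koszulChainComplex a).d (i + 1) i w = t • (⟨z, hz⟩ : ⋀[R]^i (Fin n → R)) := hw
  rw [koszulHomology_differential_prev] at h2
  have h3 : koszulContract a (w : ⋀[R]^(i + 1) (Fin n → R)).1 = t • z := congrArg Subtype.val h2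
  rw [h3, sub_self]
  exact zero_mem _

lemma subsingleton_koszulHomology_of_annihilates (a : Fin n → R) (i : ℕ)
    (h : AnnihilatesKoszul a ⊥ i 1) : Subsingleton (koszulHomology a i) := by
  have : Subsingleton
      ((koszulChainComplex a).sc' (i + 1) i ((ComplexShape.down ℕ).next i)).homology := by
    refine subsingleton_homology_of_forall_exists _ fun z hz => ?_
    have hz' := (koszulDifferential_next_eq_zero_iff a i z).mp hz
    obtain ⟨u, hu, hzu⟩ := h (z : ⋀[R]^i (Fin n → R)).1 (z : ⋀[R]^i (Fin n → R)).2
      (by rw [hz']; exact zero_mem _)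
    refine ⟨(⟨u, hu⟩ : ⋀[R]^(i + 1) (Fin n → R)), ?_⟩
    change (koszulChainComplex a).d (i + 1) i _ = _
    rw [koszulHomology_differential_prev]
    refine Subtype.ext ?_
    rw [Submodule.bot_smul, Submodule.mem_bot, one_smul] at hzu
    exact (sub_eq_zero.mp hzu).symm
  exact (koszulHomologyIso a i).toLinearEquiv.toEquiv.subsingleton

/-- Projecting to degree `j` makes the multiple of `x` homogeneous. -/
lemma exists_sub_smul_mem_of_mem_sup_smul_top {K : Ideal R} {x : R} {j : ℕ}
    {y : ExteriorAlgebra R (Fin n → R)} (hy : y ∈ ⋀[R]^j (Fin n → R))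
    (hyK : y ∈ (K ⊔ Ideal.span {x}) • (⊤ : Submodule R (ExteriorAlgebra R (Fin n → R)))) :
    ∃ w ∈ ⋀[R]^j (Fin n → R),
      y - x • w ∈ K • (⊤ : Submodule R (ExteriorAlgebra R (Fin n → R))) := by
  let π := GradedAlgebra.proj (fun i : ℕ => ⋀[R]^i (Fin n → R)) j
  rw [Submodule.sup_smul, Submodule.mem_sup] at hyK
  obtain ⟨κ, hκ, y', hy', rfl⟩ := hyK
  rw [Submodule.ideal_span_singleton_smul] at hy'
  obtain ⟨w, -, rfl⟩ := hy'
  refine ⟨π w, by simp [π, GradedAlgebra.proj_apply], ?_⟩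
  have h1 : π (κ + x • w) = κ + x • w := by
    simp only [π, GradedAlgebra.proj_apply]
    exact DirectSum.decompose_of_mem_same _ hy
  have h2 : κ + x • w - x • π w = π κ := by
    rw [← h1, map_add, map_smul, add_sub_cancel_right]
  exact h2 ▸ map_mem_smul_top π hκ

lemma mem_smul_top_of_smul_mem {K : Ideal R} {x : R} (hx : ∀ y, x * y ∈ K → y ∈ K)
    {v : ExteriorAlgebra R (Fin n → R)}
    (hv : x • v ∈ K • (⊤ : Submodule R (ExteriorAlgebra R (Fin n → R)))) :
    v ∈ K • (⊤ : Submodule R (ExteriorAlgebra R (Fin n → R))) := by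
  rw [mem_smul_top_iff_forall_repr (Pi.basisFun R (Fin n)).ExteriorAlgebra] at hv ⊢
  intro i
  refine hx _ ?_
  simpa using hv i

section Step

variable {a : Fin n → R} {K : Ideal R} {x : R} (hx : ∀ y, x * y ∈ K → y ∈ K)

include hx

/-- Vanishing of the Koszul homology of `R ⧸ (K + (x))` in degree `j + 1` implies that of `R ⧸ K`
in degree `j`. -/
lemma AnnihilatesKoszul.one_of_sup (hxa : x ∈ Ideal.span (Set.range a)) {j : ℕ}
    (h : AnnihilatesKoszul a (K ⊔ Ideal.span {x}) (j + 1) 1) : AnnihilatesKoszul a K j 1 := by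
  intro z hz hdz
  -- With `x = ∑ e i * a i`, multiplication by `e` is a homotopy: d(e ∧ z) = xz - e ∧ dz. If e ∧ z ≡
  -- du + xv modulo `K`, applying d gives xz ≡ x dv, and `x` cancels.
  obtain ⟨e, he⟩ := (Submodule.mem_span_range_iff_exists_fun R).mp hxa
  have hform : koszulForm a e = x := by
    rw [← he]; simp [koszulForm, Fintype.linearCombination_apply]
  have hez : ExteriorAlgebra.ι R e * z ∈ ⋀[R]^(j + 1) (Fin n → R) := by
    rw [ExteriorAlgebra.exteriorPower, pow_succ']
    exact Submodule.mul_mem_mul ⟨e, rfl⟩ hz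
  have hdez := koszulContract_ι_mul a e z
  rw [hform] at hdez
  have hedz : ExteriorAlgebra.ι R e * koszulContract a z ∈
      K • (⊤ : Submodule R (ExteriorAlgebra R (Fin n → R))) :=
    map_mem_smul_top (LinearMap.mulLeft R (ExteriorAlgebra.ι R e)) hdz
  obtain ⟨u, hu, hzu⟩ := h _ hez (by
    rw [hdez]
    refine sub_mem (Submodule.smul_mem_smul (le_sup_right (a := K)
      (Ideal.mem_span_singleton_self x)) trivial) (Submodule.smul_mono_left le_sup_left hedz))
  rw [one_smul] at hzu
  obtain ⟨v, hv, hzuv⟩ := exists_sub_smul_mem_of_mem_sup_smul_top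
    (sub_mem hez (koszulContract_mem a _ u hu)) hzu
  refine ⟨v, hv, mem_smul_top_of_smul_mem hx ?_⟩
  have h1 := map_mem_smul_top (koszulContract a) hzuv
  rw [map_sub, map_sub, koszulContract_koszulContract, sub_zero, map_smul, hdez] at h1
  convert! add_mem h1 hedz using 1
  rw [one_smul, smul_sub]
  abel

/-- If the Koszul homology of `R ⧸ K` vanishes in degree `j + 1`, then the annihilator of that in
degree `j` annihilates the Koszul homology of `R ⧸ (K + (x))` in degree `j + 1`. -/
lemma AnnihilatesKoszul.sup {j : ℕ} {t : R} (h₁ : AnnihilatesKoszul a K (j + 1) 1)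
    (ht : AnnihilatesKoszul a K j t) :
    AnnihilatesKoszul a (K ⊔ Ideal.span {x}) (j + 1) t := by
  intro z hz hdz
  -- Connecting map: dz ≡ xw with `w` a cycle modulo `K`. Writing tw ≡ du makes tz - xu a cycle
  -- modulo `K`, hence a boundary there.
  obtain ⟨w, hw, hzw⟩ := exists_sub_smul_mem_of_mem_sup_smul_top (koszulContract_mem a _ z hz) hdz
  have hdw : koszulContract a w ∈ K • (⊤ : Submodule R (ExteriorAlgebra R (Fin n → R))) := by
    refine mem_smul_top_of_smul_mem hx ?_
    have h1 := map_mem_smul_top (koszulContract a) hzw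
    rw [map_sub, koszulContract_koszulContract, zero_sub, neg_mem_iff, map_smul] at h1
    exact h1
  obtain ⟨u, hu, hwu⟩ := ht w hw hdw
  obtain ⟨u', hu', hzu⟩ := h₁ (t • z - x • u)
    (sub_mem (Submodule.smul_mem _ _ hz) (Submodule.smul_mem _ _ hu)) (by
      rw [map_sub, map_smul, map_smul]
      convert! add_mem (Submodule.smul_mem _ t hzw) (Submodule.smul_mem _ x hwu) using 1
      rw [smul_sub, smul_sub, smul_comm t x]
      abel)
  refine ⟨u', hu', ?_⟩
  rw [one_smul] at hzu
  have h2 : x • u ∈ (K ⊔ Ideal.span {x}) •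
      (⊤ : Submodule R (ExteriorAlgebra R (Fin n → R))) :=
    Submodule.smul_mem_smul (le_sup_right (a := K) (Ideal.mem_span_singleton_self x)) trivial
  convert! add_mem (Submodule.smul_mono_left le_sup_left hzu) h2 using 1
  abel

end Step

open RingTheory.Sequence

lemma isWeaklyRegular_append_singleton_iff {l : List R} {x : R} :
    IsWeaklyRegular R (l ++ [x]) ↔
      IsWeaklyRegular R l ∧ ∀ y, x * y ∈ Ideal.ofList l → y ∈ Ideal.ofList l := by
  rw [isWeaklyRegular_append_iff, isWeaklyRegular_singleton_iff,
    isSMulRegular_quotient_iff_mem_of_smul_mem]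
  simp

lemma AnnihilatesKoszul.one_bot_of_isWeaklyRegular {a : Fin n → R} (rs : List R)
    (hrs : IsWeaklyRegular R rs) (ha : ∀ x ∈ rs, x ∈ Ideal.span (Set.range a)) {j : ℕ}
    (h : AnnihilatesKoszul a (Ideal.ofList rs) (j + rs.length) 1) :
    AnnihilatesKoszul a ⊥ j 1 := by
  induction rs using List.reverseRecOn with
  | nil => simpa using h
  | append_singleton l x ih =>
    obtain ⟨hl, hx⟩ := isWeaklyRegular_append_singleton_iff.mp hrs
    refine ih hl (fun y hy => ha y (by simp [hy])) (one_of_sup hx (ha x (by simp)) ?_)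
    simpa [add_assoc] using h

lemma AnnihilatesKoszul.ofList_of_isWeaklyRegular {a : Fin n → R} (rs : List R)
    (hrs : IsWeaklyRegular R rs) (ha : ∀ x ∈ rs, x ∈ Ideal.span (Set.range a)) {j : ℕ} {t : R}
    (h : ∀ i, j + rs.length < i → AnnihilatesKoszul a (Ideal.ofList rs) i 1)
    (ht : AnnihilatesKoszul a ⊥ j t) :
    AnnihilatesKoszul a (Ideal.ofList rs) (j + rs.length) t := by
  induction rs using List.reverseRecOn with
  | nil => simpa using ht
  | append_singleton l x ih =>
    obtain ⟨hl, hx⟩ := isWeaklyRegular_append_singleton_iff.mp hrs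
    -- Vanishing in high degrees descends from the full list to `l`, which supplies the vanishing
    -- needed by `AnnihilatesKoszul.sup`.
    have h1 : ∀ i, j + l.length < i → AnnihilatesKoszul a (Ideal.ofList l) i 1 := fun i hi =>
      one_of_sup hx (ha x (by simp)) (by
        have := h (i + 1) (by simp; omega)
        simpa using this)
    have := AnnihilatesKoszul.sup hx (h1 _ (Nat.lt_succ_self _))
      (ih hl (fun y hy => ha y (by simp [hy])) h1)
    simpa [add_assoc] using this

lemma eq_zero_of_mem_exteriorPower_of_lt {j : ℕ} (hj : n < j) {z : ExteriorAlgebra R (Fin n → R)}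
    (hz : z ∈ ⋀[R]^j (Fin n → R)) : z = 0 := by
  have : IsEmpty (Set.powersetCard (Fin n) j) := ⟨fun s => by
    have h1 : s.1.card = j := s.2
    have h2 := s.1.card_le_univ
    rw [Fintype.card_fin] at h2
    omega⟩
  have := ((Pi.basisFun R (Fin n)).exteriorPower j).repr.toEquiv.subsingleton
  exact congrArg Subtype.val (Subsingleton.elim (⟨z, hz⟩ : ⋀[R]^j (Fin n → R)) 0)

lemma annihilatesKoszul_of_lt (a : Fin n → R) (K : Ideal R) {j : ℕ} (hj : n < j) (t : R) :
    AnnihilatesKoszul a K j t := fun z hz _ =>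
  ⟨0, zero_mem _, by rw [eq_zero_of_mem_exteriorPower_of_lt hj hz]; simp⟩

lemma koszulContract_mem_smul_top (a : Fin n → R) (z : ExteriorAlgebra R (Fin n → R)) :
    koszulContract a z ∈ Ideal.span (Set.range a) •
      (⊤ : Submodule R (ExteriorAlgebra R (Fin n → R))) := by
  induction z using CliffordAlgebra.left_induction with
  | algebraMap r =>
    have h : koszulContract a (algebraMap R _ r) = 0 :=
      CliffordAlgebra.contractLeft_algebraMap _ _ _
    exact h ▸ zero_mem _
  | add x y hx hy => rw [map_add]; exact add_mem hx hy
  | ι_mul x m hx =>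
    have h : koszulForm a m ∈ Ideal.span (Set.range a) :=
      (Submodule.mem_span_range_iff_exists_fun R).mpr
        ⟨m, by simp [koszulForm, Fintype.linearCombination_apply]⟩
    exact (koszulContract_ι_mul a m x).symm ▸ sub_mem (Submodule.smul_mem_smul h trivial)
      (map_mem_smul_top (LinearMap.mulLeft R (ExteriorAlgebra.ι R m)) hx)

/-- The top Koszul homology of `R ⧸ K` is (K : I)/K, with I generated by `a`: `y` times the top
basis vector is a cycle because contraction has coefficients in I, and there are no boundaries in
degree `n`. -/
lemma AnnihilatesKoszul.mul_mem_of_top {a : Fin n → R} {K : Ideal R} {t : R}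
    (h : AnnihilatesKoszul a K n t) {y : R} (hy : ∀ i ∈ Ideal.span (Set.range a), i * y ∈ K) :
    t * y ∈ K := by
  let b := (Pi.basisFun R (Fin n)).ExteriorAlgebra
  have hb : b Finset.univ ∈ ⋀[R]^n (Fin n → R) := by
    have h := ExteriorAlgebra.basis_eq_coe_basis (Pi.basisFun R (Fin n))
      (⟨Finset.univ, by simp⟩ : Set.powersetCard (Fin n) n)
    exact h ▸ Subtype.property _
  obtain ⟨u, hu, hzu⟩ := h (y • b Finset.univ) (Submodule.smul_mem _ _ hb) (by
    rw [map_smul]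
    have h1 := koszulContract_mem_smul_top a (b Finset.univ)
    rw [mem_smul_top_iff_forall_repr b] at h1 ⊢
    intro i
    simpa [mul_comm] using hy _ (h1 i))
  rw [eq_zero_of_mem_exteriorPower_of_lt n.lt_succ_self hu, map_zero, sub_zero,
    mem_smul_top_iff_forall_repr b] at hzu
  simpa using hzu Finset.univ

end Koszul

/-! ### Heights, dimension and maximal regular sequences. -/

section CohenMacaulay

variable {R : Type u} [CommRing R]

lemma radical_eq_maximalIdeal_of_forall_isPrime [IsLocalRing R] {J : Ideal R} (hJ : J ≠ ⊤)
    (h : ∀ P : Ideal R, P.IsPrime → J ≤ P → P = maximalIdeal R) :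
    J.radical = maximalIdeal R := by
  rw [Ideal.radical_eq_sInf]
  refine le_antisymm (sInf_le ⟨le_maximalIdeal hJ, inferInstance⟩) (le_sInf ?_)
  rintro P ⟨hJP, hP⟩
  exact (h P hP hJP).ge

lemma height_eq_of_radical_eq_maximalIdeal [IsLocalRing R] {J : Ideal R}
    (h : J.radical = maximalIdeal R) : J.height = (maximalIdeal R).height := by
  rw [← h]
  simp only [Ideal.height, Ideal.radical_minimalPrimes]

lemma radical_eq_maximalIdeal_of_height_eq [IsLocalRing R] [IsNoetherianRing R] {J : Ideal R}
    (hJ : J ≠ ⊤) (h : J.height = (maximalIdeal R).height) : J.radical = maximalIdeal R :=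
  radical_eq_maximalIdeal_of_forall_isPrime hJ fun _ hP hJP =>
    Ideal.eq_of_le_of_height_le _ (le_maximalIdeal hP.ne_top) (h ▸ Ideal.height_mono hJP)

open RingTheory.Sequence

/-- Each element of a regular sequence lowers the dimension by one, so the quotient has dimension 0
and its minimal primes are maximal. -/
lemma radical_ofList_eq_maximalIdeal [IsLocalRing R] [IsNoetherianRing R] {rs : List R}
    (hrs : IsRegular R rs) (hdim : ringKrullDim R = rs.length) :
    (Ideal.ofList rs).radical = maximalIdeal R := by
  have hJ : Ideal.ofList rs ≠ ⊤ := fun htop => hrs.top_ne_smul (by rw [htop, Submodule.top_smul])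
  have h0 : ringKrullDim (R ⧸ Ideal.ofList rs) = 0 := by
    have := ringKrullDim_add_length_eq_ringKrullDim_of_isRegular rs hrs
    rw [hdim] at this
    induction h : ringKrullDim (R ⧸ Ideal.ofList rs) with
    | bot => rw [h] at this; simp at this
    | coe k =>
      rw [h] at this
      have h2 : k + rs.length = rs.length := by exact_mod_cast this
      simpa using h2
  have : Ring.KrullDimLE 0 (R ⧸ Ideal.ofList rs) := by
    rw [Ring.krullDimLE_iff]; exact h0.le
  refine radical_eq_maximalIdeal_of_forall_isPrime hJ fun P hP hJP => ?_
  obtain ⟨Q, hQ, hQP⟩ := Ideal.exists_minimalPrimes_le hJP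
  have hQmax := eq_maximalIdeal
    (Ideal.krullDimLE_zero_quotient_iff_forall_minimalPrimes_isMaximal.mp this Q hQ)
  exact le_antisymm (le_maximalIdeal hP.ne_top) (hQmax ▸ hQP)

/-- A Cohen–Macaulay local ring has a regular sequence of maximal length in every ideal that is
primary to the maximal ideal. -/
lemma exists_isRegular_of_radical_eq [IsCohenMacaulayLocal R] {I : Ideal R}
    (hI : I.radical = maximalIdeal R) :
    ∃ rs : List R, IsRegular R rs ∧ (∀ x ∈ rs, x ∈ I) ∧ ringKrullDim R = rs.length := by
  have hdim := IsCohenMacaulayLocal.depth_eq_dim (R := R)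
  rw [← maximalIdeal_height_eq_ringKrullDim] at hdim
  -- A finite supremum in `ℕ∞` is attained, so some regular sequence has length equal to the depth.
  have hlt : localDepth R < ⊤ := by
    rw [WithBot.coe_inj.mp hdim]
    exact Ideal.height_lt_top_of_isPrime
  have : Nonempty {rs : List R // IsRegular R rs} := ⟨⟨[], IsRegular.nil R R⟩⟩
  obtain ⟨⟨rs, hrs⟩, hlen⟩ := ENat.exists_eq_iSup_of_lt_top hlt
  obtain ⟨N, hN⟩ := Ideal.exists_radical_pow_le_of_fg I (IsNoetherian.noetherian _)
  refine ⟨rs.map (· ^ (N + 1)), isRegular_map_pow hrs N, fun x hx => ?_, ?_⟩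
  · obtain ⟨y, hy, rfl⟩ := List.mem_map.mp hx
    refine hN (Ideal.pow_le_pow_right N.le_succ (Ideal.pow_mem_pow ?_ _))
    rw [hI]
    exact isRegular_mem_maximalIdeal hrs y hy
  · rw [← maximalIdeal_height_eq_ringKrullDim, ← hdim, localDepth, ← hlen]
    simp

end CohenMacaulay

/-! ### Proof of the theorem. -/

theorem theorem2p14 {R : Type u} [CommRing R] [IsCohenMacaulayLocal R]
    (I : Ideal R) (hI : I.radical = maximalIdeal R) :
    (∀ J : Ideal R, J ≤ I → IsCompleteIntersectionIdeal J → J.height = I.height →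
      (J.colon (J.colon (I : Set R) : Set R) : Set R) ⊆ idealIntegralClosure I) ∧
    (∀ (n : ℕ) (a : Fin n → R), IsMinimalGenerators I a →
      ∃ i : ℕ, IsLastNonvanishingKoszul a i ∧
        (Module.annihilator R (koszulHomology a i) : Set R) ⊆ idealIntegralClosure I) := by
  have hItop : I ≠ ⊤ := fun h => (maximalIdeal.isMaximal R).ne_top (by
    rw [← hI, h, Ideal.radical_top])
  constructor
  · rintro J hJI ⟨rs, hrs, rfl⟩ hht x hx
    refine mem_idealIntegralClosure_of_mul_colon_le hrs
      (fun b hb => hJI (Ideal.subset_span hb))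
      (radical_eq_maximalIdeal_of_height_eq (fun h => hItop (top_le_iff.mp (h ▸ hJI)))
        (hht.trans (height_eq_of_radical_eq_maximalIdeal hI))) fun y hy => ?_
    refine Submodule.mem_colon.mp hx y (Submodule.mem_colon.mpr fun i hi => ?_)
    rw [smul_eq_mul, mul_comm]
    exact hy i hi
  · rintro n a ⟨rfl, hn⟩
    obtain ⟨rs, hrs, hrsI, hlen⟩ := exists_isRegular_of_radical_eq hI
    -- Krull's height theorem: dim R = ht I ≤ n, so the index n - dim R makes sense.
    have hle : rs.length ≤ n := by
      have h1 := Ideal.height_le_spanFinrank _ hItop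
      rw [height_eq_of_radical_eq_maximalIdeal hI, ← hn] at h1
      have h2 := maximalIdeal_height_eq_ringKrullDim (R := R)
      rw [hlen] at h2
      have h3 : (maximalIdeal R).height = rs.length := by exact_mod_cast h2
      rw [h3] at h1
      exact_mod_cast h1
    obtain ⟨i, hi⟩ := Nat.exists_eq_add_of_le' hle
    have hann : ∀ t ∈ Module.annihilator R (koszulHomology a i),
        t ∈ idealIntegralClosure (Ideal.span (Set.range a)) := fun t ht => by
      have h1 := AnnihilatesKoszul.ofList_of_isWeaklyRegular rs hrs.toIsWeaklyRegular hrsI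
        (fun k hk => annihilatesKoszul_of_lt a _ (by omega) 1)
        (annihilatesKoszul_bot_of_mem_annihilator a i ht)
      rw [← hi] at h1
      exact mem_idealIntegralClosure_of_mul_colon_le hrs hrsI
        (radical_ofList_eq_maximalIdeal hrs hlen) fun y hy => h1.mul_mem_of_top hy
    refine ⟨i, ⟨?_, fun j hj => ?_⟩, hann⟩
    -- If the homology vanished, 1 would annihilate it and so be integral over the proper ideal I.
    · by_contra h
      rw [not_nontrivial_iff_subsingleton] at h
      exact one_notMem_idealIntegralClosure hItop (hann 1 (by
        rw [Module.mem_annihilator]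
        exact fun _ => Subsingleton.elim _ _))
    -- The shift by `rs.length` takes `j > i` to a degree above `n`, where the exterior power is
    -- zero.
    · exact subsingleton_koszulHomology_of_annihilates a j
        (AnnihilatesKoszul.one_bot_of_isWeaklyRegular rs hrs.toIsWeaklyRegular hrsI
          (annihilatesKoszul_of_lt a _ (by omega) 1))
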